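/- **Theorem (construction of the Hilbert space).** Let $\mathbb D$ be $\mathbb R$, $\mathbb C$ or $\mathbb H$, with its usual absolute value and conjugation. Let $W$ (the set $W(P)$ of all yes-no questions) be a complete, atomic, orthomodular lattice, with orthocomplementation $q\mapsto q^\perp$. Let $V$ be a left vector space over $\mathbb D$ with a Hausdorff vector space topology (for example a Banach space), and let $\mathcal L$ be the lattice of all closed linear subspaces of $V$, ordered by inclusion. Suppose that there is a lattice isomorphism $W\cong\mathcal L$, and carry $^\perp$ over to $\mathcal L$ by it. An involutory anti-automorphism $\theta$ of $\mathbb D$ is an additive map with $\theta(ab)=\theta(b)\theta(a)$ and $\theta(\theta(a))=a$. A $\theta$-product on $V$ is a map $f:V\times V\to\mathbb D$ that is linear in the first variable, additive in the second, and satisfies $f(x,by)=f(x,y)\theta(b)$, $\theta(f(x,y))=f(y,x)$, and $f(x,x)=0\Rightarrow x=0$. Call $\theta$ associated with $^\perp$ if for some $v_1\in V\setminus\{0\}$ there is a $\theta$-product $f$ on $V$ with $f(v_1,v_1)=1$ and $f(v,u)=0\Leftrightarrow v\in(\mathbb D u)^\perp$ for all $u,v\in V$. If $\dim V\ge 4$,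 assume that every involutory anti-automorphism $\theta$ of $\mathbb D$ associated with $^\perp$ is continuous. Then there is an inner product $f$ on $V$ (that is, a $\theta$-product for $\theta$ the conjugation of $\mathbb D$, with $f(x,x)$ real and positive for $x\ne0$) such that $V$ with $f$ is a Hilbert space, i.e. is complete for the norm $\|x\|=f(x,x)^{1/2}$, and the subspaces of $V$ that are closed for this norm are exactly the members of $\mathcal L$. If $\dim V\geq 4$, then $f$ can moreover be chosen so that, in addition, $U^\perp=\{v\in V: f(v,u)=0\ \text{for all } u\in U\}$ for every $U\in\mathcal L$. -/

import Mathlib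

/-- An orthocomplementation `x ↦ xᗮ` on a bounded lattice. -/
structure IsOrthocomplementation {L : Type*} [Lattice L] [BoundedOrder L] (perp : L → L) :
    Prop where
  perp_perp : ∀ x, perp (perp x) = x
  le_iff : ∀ x y, x ≤ y ↔ perp y ≤ perp x
  inf_perp : ∀ x, x ⊓ perp x = ⊥
  sup_perp : ∀ x, x ⊔ perp x = ⊤

/-- The orthomodular law for an orthocomplementation. -/
structure IsOrthomodular {L : Type*} [Lattice L] [BoundedOrder L] (perp : L → L) : Prop
    extends IsOrthocomplementation perp where
  orthomodular : ∀ x z, x ≤ z → x ⊔ (perp x ⊓ z) = z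

/-- `D` is one of the fields `ℝ`, `ℂ`, `ℍ`, with its absolute value and its conjugation `star`
(which is the identity on `ℝ`). -/
def IsRealComplexOrQuaternion (D : Type*) [NormedDivisionRing D] [NormedAlgebra ℝ D]
    [StarRing D] : Prop :=
  (∃ e : D ≃⋆ₐ[ℝ] ℝ, Isometry e) ∨ (∃ e : D ≃⋆ₐ[ℝ] ℂ, Isometry e) ∨
    (∃ e : D ≃⋆ₐ[ℝ] Quaternion ℝ, Isometry e)

/-- An involutory anti-automorphism of a ring. -/
structure IsInvolutoryAntiAut {D : Type*} [Ring D] (θ : D → D) : Prop where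
  map_add : ∀ a b, θ (a + b) = θ a + θ b
  map_mul : ∀ a b, θ (a * b) = θ b * θ a
  invol : ∀ a, θ (θ a) = a

/-- A `θ`-product on a left vector space: a definite Hermitian `θ`-sesquilinear form, linear in
its first variable. -/
structure IsThetaProduct {D V : Type*} [Ring D] [AddCommGroup V] [Module D V]
    (θ : D → D) (f : V → V → D) : Prop where
  add_left : ∀ x₁ x₂ y, f (x₁ + x₂) y = f x₁ y + f x₂ y
  smul_left : ∀ (a : D) x y, f (a • x) y = a * f x y
  add_right : ∀ x y₁ y₂, f x (y₁ + y₂) = f x y₁ + f x y₂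
  smul_right : ∀ (b : D) x y, f x (b • y) = f x y * θ b
  hermitian : ∀ x y, θ (f x y) = f y x
  definite : ∀ x, f x x = 0 → x = 0

/-- `θ` is an involutory anti-automorphism associated with the orthocomplementation `perp` on
the lattice of closed subspaces of `V`: for some nonzero vector `v₁` there is a `θ`-product `f`
on `V` with `f v₁ v₁ = 1` such that `f v u = 0` exactly when `v` lies in the orthocomplement of
the line spanned by `u`. -/
def IsAssociatedAntiAut {D V : Type*} [NormedDivisionRing D] [AddCommGroup V] [Module D V]
    [TopologicalSpace V] [IsTopologicalAddGroup V] [ContinuousSMul D V]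
    (perp : ClosedSubmodule D V → ClosedSubmodule D V) (θ : D → D) : Prop :=
  IsInvolutoryAntiAut θ ∧
    ∃ (v₁ : V) (f : V → V → D), v₁ ≠ 0 ∧ IsThetaProduct θ f ∧ f v₁ v₁ = 1 ∧
      ∀ v u : V, f v u = 0 ↔ v ∈ perp (Submodule.span D {u}).closure

/-- An inner product: a product for the conjugation of `D` such that `f x x` is a positive real
number for `x ≠ 0`. -/
structure IsInnerProduct {D V : Type*} [NormedDivisionRing D] [NormedAlgebra ℝ D] [StarRing D]
    [AddCommGroup V] [Module D V] (f : V → V → D) : Prop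
    extends IsThetaProduct (star : D → D) f where
  pos : ∀ x, x ≠ 0 → ∃ r : ℝ, 0 < r ∧ f x x = algebraMap ℝ D r

/-- The norm of an inner product, `‖x‖² = f x x`. -/
noncomputable def formNorm {D V : Type*} [NormedDivisionRing D] (f : V → V → D) (x : V) : ℝ :=
  Real.sqrt ‖f x x‖

/-- `V` with the inner product `f` is a Hilbert space: `V` is complete for the metric
`d x y = formNorm f (x - y)`. -/
structure IsHilbertSpace {D V : Type*} [NormedDivisionRing D] [NormedAlgebra ℝ D] [StarRing D]
    [AddCommGroup V] [Module D V] (f : V → V → D) : Prop extends IsInnerProduct f where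
  complete : ∀ s : ℕ → V,
    (∀ ε > 0, ∃ N, ∀ m ≥ N, ∀ n ≥ N, formNorm f (s m - s n) < ε) →
      ∃ x : V, ∀ ε > 0, ∃ N, ∀ n ≥ N, formNorm f (s n - x) < ε

/-- The set `S` is closed for the metric of the inner product `f`. -/
def IsClosedForForm {D V : Type*} [NormedDivisionRing D] [AddCommGroup V]
    (f : V → V → D) (S : Set V) : Prop :=
  ∀ x : V, (∀ ε > 0, ∃ y ∈ S, formNorm f (x - y) < ε) → x ∈ S

/-! Suppose first that the dimension is at least four. If `M` is closed, so is `M + Dx`, and the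
orthomodular law for `M ≤ M + Dx` yields a decomposition of `x` along `M` and `Mᗮ`
(`IsOrthomodular.exists_mem_sub_mem`). Applied to lines, this makes "`v` lies in the orthocomplement
of `Du`" a symmetric anisotropic relation whose polars are hyperplanes. As in the Birkhoff–von
Neumann theorem, such a relation comes from a definite Hermitian form `f` for some involutory
anti-automorphism `θ` (`IsAnisotropicPolarity.exists_form`).

By hypothesis `θ` is continuous. If it fixed a non-real element, every symmetric element would be
the square of a symmetric one, in particular `-f x x`; that would produce an isotropic vector. So
symmetric elements are real, `θ` is the conjugation, and the same argument gives positivity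
(`IsThetaProduct.isInnerProduct`).

The members of the lattice are now exactly the biorthogonally closed subspaces, and each of them
splits `V`. The Amemiya–Araki theorem (`completeSpace_of_orthogonal_split`) then gives completeness,
and in a Hilbert space biorthogonally closed means norm closed.

In dimension below four, any inner product will do, since all subspaces are closed in both
topologies. -/

/-! ### Polarities and their functionals -/

/-- An anisotropic orthosymmetric relation on a vector space: `v ∈ H u` is a symmetric relation
under which every vector splits along each nonzero vector `u` and its polar `H u`. -/
structure IsAnisotropicPolarity {D V : Type*} [DivisionRing D] [AddCommGroup V] [Module D V]
    (H : V → Submodule D V) : Prop where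
  symm : ∀ u v, v ∈ H u → u ∈ H v
  eq_zero : ∀ u, u ∈ H u → u = 0
  split : ∀ u v, ∃ a : D, v - a • u ∈ H u

namespace IsAnisotropicPolarity

variable {D V : Type*} [DivisionRing D] [AddCommGroup V] [Module D V]
  {H : V → Submodule D V}

/-- The coefficient in `split` is unique because `u ∉ H u`; uniqueness makes it linear in `v`. -/
theorem exists_functional (hH : IsAnisotropicPolarity H) {u : V} (hu : u ≠ 0) :
    ∃ χ : V →ₗ[D] D, χ u = 1 ∧ ∀ v, v ∈ H u ↔ χ v = 0 := by
  choose a ha using hH.split u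
  have huniq : ∀ v b, v - b • u ∈ H u → a v = b := by
    intro v b hb
    have h1 : (a v - b) • u ∈ H u := by
      have := (H u).sub_mem hb (ha v)
      rwa [sub_sub_sub_cancel_left, ← sub_smul] at this
    by_contra hne
    rw [(H u).smul_mem_iff (sub_ne_zero.2 hne)] at h1
    exact hu (hH.eq_zero u h1)
  refine ⟨{ toFun := a, map_add' := ?_, map_smul' := ?_ }, ?_, ?_⟩
  · intro v w
    apply huniq
    have := (H u).add_mem (ha v) (ha w)
    rwa [sub_add_sub_comm, ← add_smul] at this
  · intro c v
    apply huniq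
    have := (H u).smul_mem c (ha v)
    simpa [smul_sub, smul_smul] using this
  · apply huniq
    simp
  · intro v
    constructor
    · intro h
      apply huniq
      simpa using h
    · intro h
      have := ha v
      change a v = 0 at h
      simpa [h] using this

/-- A functional with the polar of `u` as kernel, normalised at a vector `e` not in it. -/
theorem exists_normalized_functional (hH : IsAnisotropicPolarity H) {e u : V}
    (hu : e ∉ H u) :
    ∃ φ : V →ₗ[D] D, φ e = 1 ∧ ∀ v, v ∈ H u ↔ φ v = 0 := by
  have hu0 : u ≠ 0 := by
    rintro rfl
    exact hu (hH.symm _ _ (H e).zero_mem)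
  obtain ⟨χ, -, hχ⟩ := hH.exists_functional hu0
  have hce : χ e ≠ 0 := fun h => hu ((hχ e).2 h)
  refine ⟨{ toFun := fun v => χ v * (χ e)⁻¹, map_add' := ?_, map_smul' := ?_ }, ?_, ?_⟩
  · intro v w; simp [add_mul]
  · intro c v; simp [mul_assoc]
  · simp [hce]
  · intro v
    rw [hχ]
    simp [hce]

theorem notMem_polar_add (hH : IsAnisotropicPolarity H) {e y : V} (he : e ≠ 0) (hy : y ∈ H e) :
    e ∉ H (e + y) := by
  intro h
  have h1 := hH.symm _ _ h
  exact he (hH.eq_zero e (by simpa using (H e).sub_mem h1 hy))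

/-- A system of functionals describing the polarity on the affine hyperplane `e + H e`. -/
theorem exists_affine_functionals (hH : IsAnisotropicPolarity H) {e : V} (he : e ≠ 0) :
    ∃ (φ : V →ₗ[D] D) (ψ : V → V →ₗ[D] D), φ e = 1 ∧ (∀ v, v ∈ H e ↔ φ v = 0) ∧
      (∀ y ∈ H e, ψ y e = 0) ∧
      (∀ y ∈ H e, ∀ v, v ∈ H y ↔ ψ y v = 0) ∧
      ∀ y ∈ H e, ∀ v, v ∈ H (e + y) ↔ φ v + ψ y v = 0 := by
  obtain ⟨φ, hφe, hφ⟩ := hH.exists_normalized_functional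
    (fun h => he (hH.eq_zero e h))
  have key : ∀ y, ∃ g : V →ₗ[D] D, y ∈ H e → g e = 1 ∧ ∀ v, v ∈ H (e + y) ↔ g v = 0 := by
    intro y
    by_cases hy : y ∈ H e
    · obtain ⟨g, hg⟩ := hH.exists_normalized_functional (hH.notMem_polar_add he hy)
      exact ⟨g, fun _ => hg⟩
    · exact ⟨0, fun h => absurd h hy⟩
  choose g hg using key
  -- On `H e` being polar to `y` and to `e + y` is the same thing, so `g y` describes `H y` there;
  -- subtracting `φ` makes it vanish at `e`, which lies in `H y`.
  refine ⟨φ, fun y => g y - φ, hφe, hφ, ?_, ?_, ?_⟩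
  · intro y hy
    simp [hφe, (hg y hy).1]
  · intro y hy v
    obtain ⟨hge, hgk⟩ := hg y hy
    set x := v - φ v • e with hx
    have hxe : x ∈ H e := by rw [hφ]; simp [hx, hφe]
    have hv : v = φ v • e + x := by simp [hx]
    have hey : e ∈ H y := hH.symm _ _ hy
    have h1 : v ∈ H y ↔ x ∈ H y := by
      conv_lhs => rw [hv]
      exact (H y).add_mem_iff_right ((H y).smul_mem _ hey)
    have hex : e ∈ H x := hH.symm _ _ hxe
    have h2 : x ∈ H y ↔ x ∈ H (e + y) := by
      constructor
      · intro h
        exact hH.symm _ _ ((H x).add_mem hex (hH.symm _ _ h))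
      · intro h
        exact hH.symm _ _ (((H x).add_mem_iff_right hex).1 (hH.symm _ _ h))
    rw [h1, h2, hgk]
    simp [hx, hge]
  · intro y hy v
    rw [(hg y hy).2]
    simp

end IsAnisotropicPolarity

/-- If the kernel of `h` is contained in the kernel of `k`, then `k` is a right multiple of `h`. -/
theorem LinearMap.exists_eq_mul_of_ker {D V : Type*} [DivisionRing D] [AddCommGroup V] [Module D V]
    (h k : V →ₗ[D] D) (hk : ∀ v, h v = 0 → k v = 0) : ∃ c, ∀ v, k v = h v * c := by
  by_cases h0 : ∃ w, h w ≠ 0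
  · obtain ⟨w, hw⟩ := h0
    refine ⟨(h w)⁻¹ * k w, fun v => ?_⟩
    have := hk (v - (h v * (h w)⁻¹) • w) (by simp [hw])
    simpa [sub_eq_zero, mul_assoc] using this
  · push Not at h0
    exact ⟨0, fun v => by simp [hk v (h0 v)]⟩

/-- If `ker g ∩ ker h ⊆ ker k` and `g e = 1`, `h e = 0`, then `k` is a combination of `g`, `h`. -/
theorem LinearMap.exists_eq_mul_add_mul_of_ker {D V : Type*} [DivisionRing D] [AddCommGroup V]
    [Module D V] (g h k : V →ₗ[D] D) {e : V} (hg : g e = 1) (hh : h e = 0)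
    (hk : ∀ v, g v = 0 → h v = 0 → k v = 0) : ∃ c, ∀ v, k v = g v * k e + h v * c := by
  by_cases h0 : ∃ w, h w ≠ 0
  · obtain ⟨w, hw⟩ := h0
    set w' := w - g w • e with hw'
    have hgw : g w' = 0 := by simp [hw', hg]
    have hhw : h w' ≠ 0 := by simpa [hw', hh] using hw
    refine ⟨(h w')⁻¹ * k w', fun v => ?_⟩
    have := hk (v - g v • e - (h v * (h w')⁻¹) • w') (by simp [hg, hgw])
      (by simp [hh, hhw])
    simp only [map_sub, map_smul, smul_eq_mul] at this
    rw [sub_sub, sub_eq_zero] at this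
    rw [this, mul_assoc]
  · push Not at h0
    refine ⟨0, fun v => ?_⟩
    have := hk (v - g v • e) (by simp [hg]) (h0 _)
    simpa [sub_eq_zero] using this

/-! ### From a polarity to a Hermitian form -/

namespace IsAnisotropicPolarity

variable {D V : Type*} [DivisionRing D] [AddCommGroup V] [Module D V]
  {H : V → Submodule D V}

/-- Otherwise the component of `z` polar to `y` would also be polar to `z`, hence to itself, and
would vanish. -/
theorem exists_mem_notMem (hH : IsAnisotropicPolarity H) {y z : V} (hyz : ∀ a : D, z ≠ a • y) :
    ∃ x, x ∈ H y ∧ x ∉ H z := by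
  by_contra! hcon
  obtain ⟨a, ha⟩ := hH.split y z
  have h1 := hH.symm _ _ (hcon _ ha)
  have h2 := hH.symm _ _ ha
  have h3 : z - a • y ∈ H (z - a • y) := (H _).sub_mem h1 ((H _).smul_mem _ h2)
  exact hyz a (sub_eq_zero.1 (hH.eq_zero _ h3))

/-- An anisotropic polarity on a vector space of dimension at least three is given by a definite
Hermitian form. -/
theorem exists_form (hH : IsAnisotropicPolarity H)
    (hdim : ∀ a b : V, ∃ w, w ∉ Submodule.span D {a, b}) :
    ∃ (θ : D → D) (v₁ : V) (f : V → V → D), IsInvolutoryAntiAut θ ∧ v₁ ≠ 0 ∧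
      IsThetaProduct θ f ∧ f v₁ v₁ = 1 ∧ ∀ v u, f v u = 0 ↔ v ∈ H u := by
  obtain ⟨e, he⟩ : ∃ e : V, e ≠ 0 := by
    obtain ⟨w, hw⟩ := hdim 0 0
    refine ⟨w, ?_⟩
    rintro rfl
    exact hw (Submodule.zero_mem _)
  obtain ⟨φ, ψ, hφe, hφ, hψe, hψ, hφψ⟩ := hH.exists_affine_functionals he
  -- additivity for independent vectors
  have hadd1 : ∀ y ∈ H e, ∀ z ∈ H e, ∃ c, ∀ v, ψ (y + z) v = ψ y v + ψ z v * c := by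
    intro y hy z hz
    -- A vector polar to `e + y` and to `z` is polar to `e + y + z`. Evaluation at `e` makes the
    -- first coefficient 1.
    obtain ⟨c, hc⟩ := LinearMap.exists_eq_mul_add_mul_of_ker (φ + ψ y) (ψ z) (φ + ψ (y + z))
      (e := e) (by simp [hφe, hψe y hy]) (hψe z hz) (by
        intro v h1 h2
        have h1' := hH.symm _ _ ((hφψ y hy v).2 h1)
        have h2' := hH.symm _ _ ((hψ z hz v).2 h2)
        have := hH.symm _ _ ((H v).add_mem h1' h2')
        rw [add_assoc] at this
        exact (hφψ _ ((H e).add_mem hy hz) v).1 this)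
    refine ⟨c, fun v => ?_⟩
    have := hc v
    simpa [hφe, hψe _ ((H e).add_mem hy hz), add_assoc] using this
  have hadd2 : ∀ y ∈ H e, ∀ z ∈ H e, y ≠ 0 → (∀ a : D, z ≠ a • y) →
      ∀ v, ψ (y + z) v = ψ y v + ψ z v := by
    intro y hy z hz hy0 hyz v
    obtain ⟨c, hc⟩ := hadd1 y hy z hz
    -- At a vector polar to `y` but not to `z`, the expansions in the two orders agree only if `c =
    -- 1`.
    obtain ⟨d, hd⟩ := hadd1 z hz y hy
    obtain ⟨x, hx1, hx2⟩ := hH.exists_mem_notMem hyz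
    rw [hψ y hy] at hx1
    rw [hψ z hz] at hx2
    have h1 := hc x
    have h2 := hd x
    rw [add_comm z y, h1, hx1] at h2
    have h3 : c = 1 := by
      apply mul_left_cancel₀ hx2
      simpa using h2
    simp [hc v, h3]
  have hindep : ∀ y ∈ H e, ∃ w ∈ H e, ∀ a : D, w ≠ a • y := by
    intro y hy
    obtain ⟨w, hw⟩ := hdim e y
    refine ⟨w - φ w • e, by rw [hφ]; simp [hφe], fun a ha => hw ?_⟩
    rw [Submodule.mem_span_pair]
    exact ⟨φ w, a, by rw [← ha]; abel⟩
  have hψ0 : ∀ v, ψ 0 v = 0 := fun v =>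
    (hψ 0 (H e).zero_mem v).1 (hH.symm _ _ (H v).zero_mem)
  have hne : ∀ {y w : V}, y ≠ 0 → (∀ a : D, w ≠ a • y) → ∀ a : D, y ≠ a • w := by
    intro y w hy hw a ha
    have ha0 : a ≠ 0 := by
      rintro rfl
      simp at ha
      exact hy ha
    exact hw a⁻¹ (by rw [ha, smul_smul, inv_mul_cancel₀ ha0, one_smul])
  have hadd : ∀ y ∈ H e, ∀ z ∈ H e, ∀ v, ψ (y + z) v = ψ y v + ψ z v := by
    intro y hy z hz v
    by_cases hy0 : y = 0
    · simp [hy0, hψ0]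
    by_cases hyz : ∀ a : D, z ≠ a • y
    · exact hadd2 y hy z hz hy0 hyz v
    push Not at hyz
    obtain ⟨a, rfl⟩ := hyz
    -- A third direction `w` makes `y + (a • y + w) = (1 + a) • y + w` computable by independent
    -- sums on both sides; then `ψ w` cancels.
    obtain ⟨w, hw, hwy⟩ := hindep y hy
    have h1 : ψ (y + (a • y + w)) v = ψ y v + ψ (a • y + w) v := by
      apply hadd2 y hy _ ((H e).add_mem hz hw) hy0
      intro b hb
      exact hwy (b - a) (by rw [sub_smul, ← hb]; abel)
    have hmul : ∀ b : D, ψ (b • y + w) v = ψ (b • y) v + ψ w v := by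
      intro b
      by_cases hb : b = 0
      · simp [hb, hψ0]
      · apply hadd2 _ ((H e).smul_mem _ hy) w hw (smul_ne_zero hb hy0)
        intro c
        rw [smul_smul]
        exact hwy _
    have h3 := hmul (1 + a)
    rw [add_smul, one_smul, add_assoc, h1, hmul a, ← add_assoc] at h3
    exact (add_right_cancel h3).symm
  -- the anti-automorphism
  have hsm : ∀ y ∈ H e, ∀ a : D, ∃ c, ∀ v, ψ (a • y) v = ψ y v * c := by
    intro y hy a
    apply LinearMap.exists_eq_mul_of_ker
    intro v hv
    rw [← hψ y hy] at hv
    exact (hψ _ ((H e).smul_mem _ hy) v).1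
      (hH.symm _ _ ((H v).smul_mem _ (hH.symm _ _ hv)))
  have hψne : ∀ y ∈ H e, y ≠ 0 → ∃ v, ψ y v = 1 := by
    intro y hy hy0
    have : ψ y y ≠ 0 := fun h => hy0 (hH.eq_zero y ((hψ y hy y).2 h))
    exact ⟨(ψ y y)⁻¹ • y, by simp [this]⟩
  obtain ⟨y₀, hy₀, hy₀0⟩ := hindep 0 (H e).zero_mem
  have hy₀ne : y₀ ≠ 0 := by simpa using hy₀0 0
  choose θ hθ₀ using hsm y₀ hy₀
  have hθind : ∀ y ∈ H e, ∀ z ∈ H e, y ≠ 0 → (∀ a : D, z ≠ a • y) → ∀ a c : D,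
      (∀ v, ψ (a • y) v = ψ y v * c) → ∀ v, ψ (a • z) v = ψ z v * c := by
    intro y hy z hz hy0 hyz a c hc v
    obtain ⟨d, hd⟩ := hsm z hz a
    obtain ⟨d', hd'⟩ := hsm _ ((H e).add_mem hy hz) a
    -- Two expansions of `ψ (a • (y + z))`. Vectors polar to exactly one of `y`, `z` identify the
    -- coefficients.
    have heq : ∀ x, (ψ y x + ψ z x) * d' = ψ y x * c + ψ z x * d := by
      intro x
      rw [← hadd y hy z hz, ← hd' x, smul_add, hadd _ ((H e).smul_mem _ hy) _
        ((H e).smul_mem _ hz), hc, hd]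
    have hz0 : z ≠ 0 := by simpa using hyz 0
    obtain ⟨x, hx1, hx2⟩ := hH.exists_mem_notMem hyz
    obtain ⟨x', hx1', hx2'⟩ := hH.exists_mem_notMem (hne hy0 hyz)
    rw [hψ y hy] at hx1 hx2'
    rw [hψ z hz] at hx2 hx1'
    have e1 : d' = d := mul_left_cancel₀ hx2 (by simpa [hx1] using heq x)
    have e2 : d' = c := mul_left_cancel₀ hx2' (by simpa [hx1'] using heq x')
    rw [hd, ← e1, e2]
  have hθ : ∀ y ∈ H e, ∀ a v, ψ (a • y) v = ψ y v * θ a := by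
    intro y hy a v
    by_cases hyy : ∀ b : D, y ≠ b • y₀
    · exact hθind y₀ hy₀ y hy hy₀ne hyy a _ (hθ₀ a) v
    push Not at hyy
    obtain ⟨b, rfl⟩ := hyy
    by_cases hb : b = 0
    · simp [hb, hψ0]
    -- A multiple of `y₀` is compared with `y₀` through a vector independent of both.
    obtain ⟨w, hw, hwy⟩ := hindep y₀ hy₀
    have h1 := hθind y₀ hy₀ w hw hy₀ne hwy a _ (hθ₀ a)
    refine hθind w hw _ hy (by simpa using hwy 0) ?_ a _ h1 v
    intro c hc
    exact hne hy₀ne hwy (b⁻¹ * c) (by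
      rw [mul_smul, ← hc, smul_smul, inv_mul_cancel₀ hb, one_smul])
  obtain ⟨x₀, hx₀⟩ := hψne y₀ hy₀ hy₀ne
  have hθx : ∀ a, ψ (a • y₀) x₀ = θ a := fun a => by rw [hθ y₀ hy₀, hx₀, one_mul]
  have hθadd : ∀ a b, θ (a + b) = θ a + θ b := by
    intro a b
    rw [← hθx, add_smul, hadd _ ((H e).smul_mem _ hy₀) _ ((H e).smul_mem _ hy₀), hθx, hθx]
  have hθmul : ∀ a b, θ (a * b) = θ b * θ a := by
    intro a b
    rw [← hθx, mul_smul, hθ _ ((H e).smul_mem _ hy₀), hθx]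
  have hθ1 : θ 1 = 1 := by rw [← hθx, one_smul, hx₀]
  have hθ0 : θ 0 = 0 := by rw [← hθx, zero_smul, hψ0]
  have hθneg : ∀ a, θ (-a) = -θ a := by
    intro a
    rw [eq_neg_iff_add_eq_zero, ← hθadd, neg_add_cancel, hθ0]
  -- symmetry
  have hsymm : ∀ x ∈ H e, ∀ y ∈ H e, ψ x y = θ (ψ y x) := by
    intro x hx y hy
    by_cases hb : ψ y x = 0
    · rw [hb, hθ0, ← hψ x hx]
      rw [← hψ y hy] at hb
      exact hH.symm _ _ hb
    -- Chosen so that `b • e + x` is polar to `e + y`. After division by `b`, symmetry of the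
    -- polarity reads `1 + ψ x y * θ b⁻¹ = 0`.
    set b := -ψ y x with hbdef
    have hb0 : b ≠ 0 := neg_ne_zero.2 hb
    have h1 : b • e + x ∈ H (e + y) := by
      rw [hφψ y hy]
      simp [hφe, hψe y hy, (hφ x).1 hx, hbdef]
    have h2 : e + y ∈ H (e + b⁻¹ • x) := by
      have h3 := (H (e + y)).smul_mem b⁻¹ h1
      rw [smul_add, smul_smul, inv_mul_cancel₀ hb0, one_smul] at h3
      exact hH.symm _ _ h3
    have hxb := (H e).smul_mem b⁻¹ hx
    rw [hφψ _ hxb] at h2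
    rw [map_add, map_add, hφe, (hφ y).1 hy, hψe _ hxb, hθ x hx] at h2
    have h4 : θ b⁻¹ * θ b = 1 := by rw [← hθmul, mul_inv_cancel₀ hb0, hθ1]
    have h5 : ψ x y * θ b⁻¹ = -1 := by
      rw [add_zero, zero_add] at h2
      exact (neg_eq_of_add_eq_zero_right h2).symm
    have h6 : ψ x y = -θ b := by
      rw [← mul_one (ψ x y), ← h4, ← mul_assoc, h5, neg_one_mul]
    rw [h6, hbdef, hθneg, neg_neg]
  have hinv : ∀ a, θ (θ a) = a := by
    intro a
    -- Every scalar `a` is a value `ψ y₀ x` with `x ∈ H e`, so applying the symmetry twice gives `θ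
    -- (θ a) = a`.
    set x := a • (x₀ - φ x₀ • e) with hx
    have hxe : x ∈ H e := by rw [hφ]; simp [hx, hφe]
    have hxa : ψ y₀ x = a := by simp [hx, hψe y₀ hy₀, hx₀]
    rw [← hxa, ← hsymm x hxe y₀ hy₀, ← hsymm y₀ hy₀ x hxe]
  set p : V → V := fun x => x - φ x • e with hp
  have hpe : ∀ x, p x ∈ H e := fun x => by rw [hφ]; simp [hp, hφe]
  have hpadd : ∀ x y, p (x + y) = p x + p y := fun x y => by
    simp only [hp, map_add, add_smul]; abel
  have hpsmul : ∀ (a : D) x, p (a • x) = a • p x := fun a x => by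
    simp [hp, smul_sub, smul_smul]
  have hψp : ∀ y ∈ H e, ∀ v, ψ y v = ψ y (p v) := fun y hy v => by simp [hp, hψe y hy]
  -- The orthogonal sum of the form `a * θ b` on the line of `e` and of `ψ` on `H e`.
  set f : V → V → D := fun x y => φ x * θ (φ y) + ψ (p y) x with hf
  have hker : ∀ v u, f v u = 0 ↔ v ∈ H u := by
    intro v u
    by_cases hu0 : φ u = 0
    · have : u ∈ H e := (hφ u).2 hu0
      have hpu : p u = u := by simp [hp, hu0]
      rw [hψ u this]
      simp [hf, hu0, hθ0, hpu]
    · have h1 : v ∈ H u ↔ v ∈ H (e + (φ u)⁻¹ • p u) := by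
        have h2 : e + (φ u)⁻¹ • p u = (φ u)⁻¹ • u := by
          simp only [hp, smul_sub, smul_smul, inv_mul_cancel₀ hu0, one_smul, add_sub_cancel]
        rw [h2]
        constructor
        · exact fun h => hH.symm _ _ ((H v).smul_mem _ (hH.symm _ _ h))
        · exact fun h => hH.symm _ _ (((H v).smul_mem_iff (inv_ne_zero hu0)).1 (hH.symm _ _ h))
      have h4 : θ (φ u)⁻¹ * θ (φ u) = 1 := by rw [← hθmul, mul_inv_cancel₀ hu0, hθ1]
      rw [h1, hφψ _ ((H e).smul_mem _ (hpe u)), hθ _ (hpe u)]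
      have h5 : f v u = (φ v + ψ (p u) v * θ (φ u)⁻¹) * θ (φ u) := by
        rw [add_mul, mul_assoc, h4, mul_one]
      rw [h5, mul_eq_zero, or_iff_left (right_ne_zero_of_mul_eq_one h4)]
  refine ⟨θ, e, f, ⟨hθadd, hθmul, hinv⟩, he, ⟨?_, ?_, ?_, ?_, ?_, ?_⟩, ?_, hker⟩
  · intro x₁ x₂ y
    simp only [hf, map_add, add_mul]; abel
  · intro a x y
    simp only [hf, map_smul, smul_eq_mul, mul_add, mul_assoc]
  · intro x y₁ y₂
    simp only [hf, map_add, hθadd, hpadd, hadd _ (hpe _) _ (hpe _), mul_add]; abel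
  · intro b x y
    simp only [hf, map_smul, smul_eq_mul, hθmul, hpsmul, hθ _ (hpe _), add_mul, mul_assoc]
  · intro x y
    simp only [hf, hθadd, hθmul, hinv]
    rw [hψp _ (hpe y) x, hψp _ (hpe x) y, ← hsymm _ (hpe x) _ (hpe y)]
  · intro x hx
    exact hH.eq_zero x ((hker x x).1 hx)
  · have : p e = 0 := by simp [hp, hφe]
    simp [hf, hφe, hθ1, this, hψ0]

end IsAnisotropicPolarity

/-! ### Involutions of ℝ, ℂ and ℍ -/

theorem IsRealComplexOrQuaternion.finiteDimensional {D : Type*} [NormedDivisionRing D]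
    [NormedAlgebra ℝ D] [StarRing D] (hD : IsRealComplexOrQuaternion D) :
    FiniteDimensional ℝ D := by
  rcases hD with ⟨e, -⟩ | ⟨e, -⟩ | ⟨e, -⟩
  all_goals exact Module.Finite.equiv e.symm.toAlgEquiv.toLinearEquiv

theorem IsRealComplexOrQuaternion.exists_add_star {D : Type*} [NormedDivisionRing D]
    [NormedAlgebra ℝ D] [StarRing D] (hD : IsRealComplexOrQuaternion D) (a : D) :
    ∃ r : ℝ, a + star a = algebraMap ℝ D r := by
  rcases hD with ⟨e, -⟩ | ⟨e, -⟩ | ⟨e, -⟩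
  · refine ⟨e a + e a, EquivLike.injective e ?_⟩
    simp [map_star, AlgHomClass.commutes]
  · refine ⟨2 * (e a).re, EquivLike.injective e ?_⟩
    rw [map_add, map_star, AlgHomClass.commutes, Complex.star_def, Complex.add_conj]
    simp
  · refine ⟨2 * (e a).re, EquivLike.injective e ?_⟩
    rw [map_add, map_star, AlgHomClass.commutes, Quaternion.self_add_star]
    rw [Quaternion.algebraMap_def, Quaternion.coe_mul]
    rfl

theorem IsRealComplexOrQuaternion.mul_star_self {D : Type*} [NormedDivisionRing D]
    [NormedAlgebra ℝ D] [StarRing D] (hD : IsRealComplexOrQuaternion D) (a : D) :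
    a * star a = algebraMap ℝ D (‖a‖ ^ 2) := by
  rcases hD with ⟨e, he⟩ | ⟨e, he⟩ | ⟨e, he⟩
  all_goals
    have hn : ‖e a‖ = ‖a‖ := by
      have := he.dist_eq a 0
      rwa [map_zero, dist_zero_right, dist_zero_right] at this
    apply EquivLike.injective e
    rw [map_mul, map_star, AlgHomClass.commutes, ← hn]
  · simp [← sq]
  · simp [Complex.mul_conj, Complex.normSq_eq_norm_sq]
  · rw [Quaternion.self_mul_star, Quaternion.normSq_eq_norm_mul_self, sq]
    rfl

theorem IsRealComplexOrQuaternion.star_algebraMap {D : Type*} [NormedDivisionRing D]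
    [NormedAlgebra ℝ D] [StarRing D] (hD : IsRealComplexOrQuaternion D) (r : ℝ) :
    star (algebraMap ℝ D r) = algebraMap ℝ D r := by
  rcases hD with ⟨e, -⟩ | ⟨e, -⟩ | ⟨e, -⟩
  all_goals
    apply EquivLike.injective e
    rw [map_star, AlgHomClass.commutes]
  · simp
  · simp
  · exact Quaternion.star_coe r

section

variable {D : Type*} [NormedDivisionRing D] [NormedAlgebra ℝ D] [StarRing D]

/-- Every element is a root of a real quadratic polynomial. -/
theorem IsRealComplexOrQuaternion.quadratic (hD : IsRealComplexOrQuaternion D) {a : D} {t : ℝ}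
    (ht : a + star a = algebraMap ℝ D t) :
    a * a = algebraMap ℝ D t * a - algebraMap ℝ D (‖a‖ ^ 2) := by
  rw [← hD.mul_star_self, Algebra.commutes, ← ht]
  noncomm_ring

end

namespace IsInvolutoryAntiAut

section

variable {D : Type*} [NormedDivisionRing D] {θ : D → D}


theorem map_zero (hθ : IsInvolutoryAntiAut θ) : θ 0 = 0 := by
  have := hθ.map_add 0 0
  simpa using this

theorem map_one (hθ : IsInvolutoryAntiAut θ) : θ 1 = 1 := by
  have := hθ.map_mul (θ 1) 1
  rwa [mul_one, hθ.invol, mul_one, eq_comm] at this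

theorem map_algebraMap [NormedAlgebra ℝ D] (hθ : IsInvolutoryAntiAut θ) (hc : Continuous θ) (r : ℝ) :
    θ (algebraMap ℝ D r) = algebraMap ℝ D r := by
  have := map_real_smul (AddMonoidHom.mk' θ hθ.map_add) hc r 1
  simpa [hθ.map_one, Algebra.algebraMap_eq_smul_one] using this

theorem map_smul [NormedAlgebra ℝ D] (hθ : IsInvolutoryAntiAut θ) (hc : Continuous θ) (r : ℝ) (a : D) :
    θ (r • a) = r • θ a :=
  map_real_smul (AddMonoidHom.mk' θ hθ.map_add) hc r a

theorem map_neg (hθ : IsInvolutoryAntiAut θ) (a : D) : θ (-a) = - θ a :=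
  _root_.map_neg (AddMonoidHom.mk' θ hθ.map_add) a

theorem map_sub (hθ : IsInvolutoryAntiAut θ) (a b : D) : θ (a - b) = θ a - θ b :=
  _root_.map_sub (AddMonoidHom.mk' θ hθ.map_add) a b

end

variable {D : Type*} [NormedDivisionRing D] [NormedAlgebra ℝ D] [StarRing D] {θ : D → D}

/-- If all symmetric elements of a continuous involutory anti-automorphism are real, it is the
conjugation. -/
theorem eq_star (hD : IsRealComplexOrQuaternion D) (hθ : IsInvolutoryAntiAut θ)
    (hc : Continuous θ) (hreal : ∀ a, θ a = a → ∃ r : ℝ, a = algebraMap ℝ D r) (a : D) :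
    θ a = star a := by
  by_cases ha : ∃ r : ℝ, a = algebraMap ℝ D r
  · obtain ⟨r, rfl⟩ := ha
    rw [hθ.map_algebraMap hc, hD.star_algebraMap]
  -- The `θ`-trace and `θ`-norm of `a` are symmetric, hence real. So `a` satisfies two monic real
  -- quadratics, and as `a` is not real their linear coefficients agree.
  obtain ⟨t, ht⟩ := hreal (a + θ a) (by rw [hθ.map_add, hθ.invol, add_comm])
  obtain ⟨n, hn⟩ := hreal (a * θ a) (by rw [hθ.map_mul, hθ.invol])
  obtain ⟨s, hs⟩ := hD.exists_add_star a
  have h1 := hD.quadratic hs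
  have h2 : θ a = algebraMap ℝ D t - a := by rw [← ht]; abel
  have h3 : star a = algebraMap ℝ D s - a := by rw [← hs]; abel
  rw [h2, mul_sub, h1, ← Algebra.commutes] at hn
  have h4 : (t - s) • a = algebraMap ℝ D (n - ‖a‖ ^ 2) := by
    rw [Algebra.smul_def, RingHom.map_sub, RingHom.map_sub, ← hn]
    noncomm_ring
  have h5 : t = s := by
    by_contra hne
    apply ha
    refine ⟨(t - s)⁻¹ * (n - ‖a‖ ^ 2), ?_⟩
    rw [RingHom.map_mul, ← h4, ← Algebra.smul_def, smul_smul, inv_mul_cancel₀ (sub_ne_zero.2 hne),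
      one_smul]
  rw [h2, h3, h5]

/-- A continuous involutory anti-automorphism with a non-real symmetric element fixes an
imaginary unit. -/
theorem exists_imaginary_unit (hD : IsRealComplexOrQuaternion D) (hθ : IsInvolutoryAntiAut θ)
    (hc : Continuous θ) {a : D} (ha : θ a = a) (hreal : ∀ r : ℝ, a ≠ algebraMap ℝ D r) :
    ∃ j, θ j = j ∧ j * j = -1 ∧ ∃ r s : ℝ, a = algebraMap ℝ D r + s • j := by
  obtain ⟨t, ht⟩ := hD.exists_add_star a
  have h1 := hD.quadratic ht
  set p := a - algebraMap ℝ D (t / 2) with hp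
  have hp1 : θ p = p := by rw [hp, hθ.map_sub, ha, hθ.map_algebraMap hc]
  have hstar : star p = -p := by
    have h3 : star a = algebraMap ℝ D t - a := by rw [← ht]; abel
    have h4 : algebraMap ℝ D t = algebraMap ℝ D (t / 2) + algebraMap ℝ D (t / 2) := by
      rw [← RingHom.map_add]; congr 1; ring
    rw [hp, star_sub, hD.star_algebraMap, h3, h4]
    abel
  have hp0 : p ≠ 0 := fun h => hreal _ (sub_eq_zero.1 h)
  have hn : ‖p‖ ≠ 0 := norm_ne_zero_iff.2 hp0
  have hpp : p * p = -algebraMap ℝ D (‖p‖ ^ 2) := by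
    rw [← hD.mul_star_self, hstar, mul_neg, neg_neg]
  refine ⟨‖p‖⁻¹ • p, ?_, ?_, t / 2, ‖p‖, ?_⟩
  · rw [hθ.map_smul hc, hp1]
  · rw [smul_mul_smul_comm, hpp, smul_neg, Algebra.smul_def, ← RingHom.map_mul]
    have : ‖p‖⁻¹ * ‖p‖⁻¹ * ‖p‖ ^ 2 = 1 := by field_simp
    rw [this, RingHom.map_one]
  · rw [smul_smul, mul_inv_cancel₀ hn, one_smul, hp]; abel

/-- For a continuous involutory anti-automorphism fixing an imaginary unit, every symmetric
element is the square of a symmetric element. -/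
theorem exists_sq_eq (hD : IsRealComplexOrQuaternion D) (hθ : IsInvolutoryAntiAut θ)
    (hc : Continuous θ) {i : D} (hi : θ i = i) (hii : i * i = -1) {a : D} (ha : θ a = a) :
    ∃ b, θ b = b ∧ b * b = a := by
  -- `a` lies in a copy of `ℂ` spanned by `1` and a symmetric imaginary unit `j`
  obtain ⟨j, hj, hjj, r, s, rfl⟩ : ∃ j, θ j = j ∧ j * j = -1 ∧
      ∃ r s : ℝ, a = algebraMap ℝ D r + s • j := by
    by_cases hreal : ∃ r : ℝ, a = algebraMap ℝ D r
    · obtain ⟨r, rfl⟩ := hreal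
      exact ⟨i, hi, hii, r, 0, by simp⟩
    · push Not at hreal
      exact hθ.exists_imaginary_unit hD hc ha hreal
  -- The square root is taken in ℂ and carried over by `Complex.I ↦ j`; the image is fixed pointwise
  -- by `θ`.
  obtain ⟨w, hw⟩ := IsAlgClosed.exists_pow_nat_eq (⟨r, s⟩ : ℂ) (n := 2) two_pos
  refine ⟨Complex.liftAux j hjj w, ?_, ?_⟩
  · rw [Complex.liftAux_apply, hθ.map_add, hθ.map_algebraMap hc, hθ.map_smul hc, hj]
  · rw [← _root_.map_mul, ← sq, hw, Complex.liftAux_apply]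

end IsInvolutoryAntiAut

/-! ### Positivity of the form -/

namespace IsThetaProduct

variable {D V : Type*} [NormedDivisionRing D] [AddCommGroup V] [Module D V]
  {θ : D → D} {f : V → V → D}

/-- Equality would make the nonzero vector `a • e + x` isotropic, its square being `a * θ a + f x
x`. -/
theorem mul_self_ne_neg (hθ : IsInvolutoryAntiAut θ) (hf : IsThetaProduct θ f) {e x : V}
    (he : f e e = 1) (hx : f x e = 0) (hx0 : x ≠ 0) {a : D} (ha : θ a = a) :
    a * a ≠ -f x x := by
  intro h
  have hex : f e x = 0 := by rw [← hf.hermitian, hx, hθ.map_zero]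
  have h0 : a • e + x = 0 := by
    apply hf.definite
    simp only [hf.add_left, hf.add_right, hf.smul_left, hf.smul_right, he, hx, hex, ha, one_mul,
      mul_zero, zero_mul, add_zero, zero_add, h]
    exact neg_add_cancel _
  have h1 : f 0 e = 0 := by simpa using hf.smul_left 0 0 e
  rw [← h0, hf.add_left, hf.smul_left, he, hx, add_zero, mul_one] at h1
  rw [h1, zero_smul, zero_add] at h0
  exact hx0 h0

/-- A non-real symmetric element would make `-f x₀ x₀` a symmetric square, against
`mul_self_ne_neg`. A negative `f y y` with `y` orthogonal to `e` is excluded by a real square root,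
and a general vector is split along `e`. -/
theorem isInnerProduct [NormedAlgebra ℝ D] [StarRing D] (hD : IsRealComplexOrQuaternion D)
    (hθ : IsInvolutoryAntiAut θ) (hc : Continuous θ) (hf : IsThetaProduct θ f) {e x₀ : V}
    (he : f e e = 1) (hx₀ : f x₀ e = 0) (hx₀0 : x₀ ≠ 0) : IsInnerProduct f := by
  have hreal : ∀ a, θ a = a → ∃ r : ℝ, a = algebraMap ℝ D r := by
    intro a ha
    by_contra! hcon
    obtain ⟨j, hj, hjj, -⟩ := hθ.exists_imaginary_unit hD hc ha hcon
    obtain ⟨b, hb, hbb⟩ := hθ.exists_sq_eq hD hc hj hjj (a := -f x₀ x₀)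
      (by rw [hθ.map_neg, hf.hermitian])
    exact hf.mul_self_ne_neg hθ he hx₀ hx₀0 hb hbb
  obtain rfl : θ = star := funext (hθ.eq_star hD hc hreal)
  refine ⟨hf, fun x hx => ?_⟩
  have hpos : ∀ y, f y e = 0 → ∃ r : ℝ, 0 ≤ r ∧ f y y = algebraMap ℝ D r := by
    intro y hy
    obtain ⟨r, hr⟩ := hreal (f y y) (hf.hermitian y y)
    refine ⟨r, ?_, hr⟩
    by_contra! hneg
    by_cases hy0 : y = 0
    · have h1 : f 0 0 = 0 := by simpa using hf.smul_left 0 0 0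
      rw [hy0, h1, eq_comm, map_eq_zero] at hr
      exact hneg.ne hr
    · apply hf.mul_self_ne_neg hθ he hy hy0 (hD.star_algebraMap (√(-r)))
      rw [hr, ← map_mul, Real.mul_self_sqrt (by linarith), map_neg]
  set a := f x e with ha
  set y := x - a • e with hy
  have hxy : x = a • e + y := by simp [hy]
  have hye : f y e = 0 := by
    have : a = f (a • e + y) e := by rw [← hxy]
    rw [hf.add_left, hf.smul_left, he, mul_one] at this
    simpa using this
  have hey : f e y = 0 := by rw [← hf.hermitian, hye, star_zero]
  obtain ⟨r, hr0, hr⟩ := hpos y hye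
  have hxx : f x x = algebraMap ℝ D (‖a‖ ^ 2 + r) := by
    rw [hxy]
    simp only [hf.add_left, hf.add_right, hf.smul_left, hf.smul_right, he, hye, hey,
      mul_zero, zero_mul, add_zero, zero_add, one_mul]
    rw [hD.mul_star_self, hr, map_add]
  refine ⟨_, lt_of_le_of_ne (by positivity) fun h => hx (hf.definite x ?_), hxx⟩
  rw [hxx, ← h, map_zero]

end IsThetaProduct

/-! ### Dense subspaces and orthogonality -/

open UniformSpace

/-- A continuous linear map of finite rank has the same range on a dense subspace. -/
theorem LinearMap.exists_map_eq_of_denseRange {E F G : Type*} [AddCommGroup E] [Module ℝ E]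
    [NormedAddCommGroup F] [NormedSpace ℝ F] [NormedAddCommGroup G] [NormedSpace ℝ G]
    [FiniteDimensional ℝ G] (ι : E →ₗ[ℝ] F) (hι : DenseRange ι) (Φ : F →L[ℝ] G) (z : F) :
    ∃ w, Φ (ι w) = Φ z := by
  have hcl : IsClosed (LinearMap.range (Φ.toLinearMap ∘ₗ ι) : Set G) :=
    Submodule.closed_of_finiteDimensional _
  exact hι.induction_on
    (p := fun y => Φ y ∈ (LinearMap.range (Φ.toLinearMap ∘ₗ ι) : Set G)) z
    (hcl.preimage Φ.continuous) fun a => ⟨a, rfl⟩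

/-- A dense subspace meets the kernel of a continuous linear map of finite rank in a dense
subspace of that kernel. -/
theorem LinearMap.exists_map_eq_zero_norm_sub_lt {E F G : Type*} [AddCommGroup E] [Module ℝ E]
    [NormedAddCommGroup F] [NormedSpace ℝ F] [NormedAddCommGroup G] [NormedSpace ℝ G]
    [FiniteDimensional ℝ G] (ι : E →ₗ[ℝ] F) (hι : DenseRange ι) (Φ : F →L[ℝ] G) {z : F}
    (hz : Φ z = 0) {ε : ℝ} (hε : 0 < ε) : ∃ w, Φ (ι w) = 0 ∧ ‖ι w - z‖ < ε := by
  set T : E →ₗ[ℝ] G := Φ.toLinearMap ∘ₗ ι with hT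
  obtain ⟨s, hs⟩ := T.rangeRestrict.exists_rightInverse_of_surjective T.range_rangeRestrict
  -- `T` and `Φ` have the same range
  have hmem : ∀ x, Φ x ∈ LinearMap.range T := ι.exists_map_eq_of_denseRange hι Φ
  set Ψ : F →L[ℝ] LinearMap.range T := Φ.codRestrict _ hmem with hΨ
  -- The map `x ↦ x - σ (Ψ x)` is continuous, fixes `z`, and sends `ι w` into the kernel and the
  -- range of `ι`; so it turns approximants of `z` into exact kernel elements.
  set σ : LinearMap.range T →L[ℝ] F := (ι ∘ₗ s).toContinuousLinearMap with hσ
  have hcont : Continuous fun x : F => x - σ (Ψ x) := by fun_prop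
  have hz0 : z - σ (Ψ z) = z := by
    have : Ψ z = 0 := Subtype.ext hz
    simp [this]
  have hopen : IsOpen {x : F | ‖x - σ (Ψ x) - z‖ < ε} :=
    isOpen_lt ((hcont.sub continuous_const).norm) continuous_const
  obtain ⟨w, hw⟩ := hι.exists_mem_open hopen ⟨z, by simp [hz0, hε]⟩
  refine ⟨w - s (Ψ (ι w)), ?_, ?_⟩
  · have h1 := LinearMap.congr_fun hs (Ψ (ι w))
    have h2 : T (s (Ψ (ι w))) = Φ (ι w) := congrArg Subtype.val h1
    have h3 : Φ (ι (s (Ψ (ι w)))) = Φ (ι w) := h2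
    rw [map_sub, map_sub, h3, sub_self]
  · rw [map_sub]
    exact hw

/-- A real inner product space with a compatible action of a ring with conjugation. -/
class IsStarInnerModule (D E : Type*) [Ring D] [Star D] [NormedAddCommGroup E]
    [InnerProductSpace ℝ E] [Module D E] : Prop where
  inner_smul_left : ∀ (a : D) (x y : E), inner ℝ (a • x) y = inner ℝ x (star a • y)

namespace IsStarInnerModule

variable {D E : Type*} [NormedDivisionRing D] [NormedAlgebra ℝ D] [StarRing D]
  [NormedAddCommGroup E] [InnerProductSpace ℝ E] [Module D E] [IsScalarTower ℝ D E]
  [IsStarInnerModule D E]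

/-- The real orthogonal complement of a `D`-submodule, as a `D`-submodule. -/
noncomputable def orthogonal (K : Submodule D E) : Submodule D E :=
  { (K.restrictScalars ℝ)ᗮ with
    smul_mem' := by
      intro a x hx
      change a • x ∈ (K.restrictScalars ℝ)ᗮ
      rw [Submodule.mem_orthogonal']
      intro u hu
      rw [inner_smul_left]
      exact Submodule.inner_left_of_mem_orthogonal (K := K.restrictScalars ℝ)
        (K.smul_mem (star a) hu) hx }

theorem mem_orthogonal {K : Submodule D E} {x : E} :
    x ∈ orthogonal K ↔ ∀ u ∈ K, inner ℝ x u = 0 :=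
  Submodule.mem_orthogonal' (K.restrictScalars ℝ) x

theorem mem_orthogonal_comm {K L : Submodule D E} (h : ∀ x ∈ K, x ∈ orthogonal L) :
    ∀ y ∈ L, y ∈ orthogonal K := fun y hy =>
  mem_orthogonal.2 fun x hx => by rw [real_inner_comm]; exact mem_orthogonal.1 (h x hx) y hy

theorem le_orthogonal_orthogonal (K : Submodule D E) : K ≤ orthogonal (orthogonal K) :=
  mem_orthogonal_comm fun _ h => h

theorem orthogonal_anti {K L : Submodule D E} (h : K ≤ L) : orthogonal L ≤ orthogonal K :=
  fun _ hx => mem_orthogonal.2 fun u hu => mem_orthogonal.1 hx u (h hu)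

theorem orthogonal_orthogonal_orthogonal (K : Submodule D E) :
    orthogonal (orthogonal (orthogonal K)) = orthogonal K :=
  le_antisymm (orthogonal_anti (le_orthogonal_orthogonal K)) (le_orthogonal_orthogonal _)

theorem exists_mem_orthogonal_norm_sub_lt {E' : Type*} [AddCommGroup E'] [Module ℝ E']
    [FiniteDimensional ℝ D] (ι : E' →ₗ[ℝ] E) (hι : DenseRange ι) (K : Submodule D E)
    [Module.Finite D K] {z : E} (hz : z ∈ orthogonal K) {ε : ℝ} (hε : 0 < ε) :
    ∃ w, ι w ∈ orthogonal K ∧ ‖ι w - z‖ < ε := by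
  have : FiniteDimensional ℝ (K.restrictScalars ℝ) := Module.Finite.trans (R := ℝ) D K
  obtain ⟨w, hw, hwz⟩ := ι.exists_map_eq_zero_norm_sub_lt hι
    (K.restrictScalars ℝ).orthogonalProjectionOnto (z := z)
    (Submodule.orthogonalProjectionOnto_eq_zero_iff.2 hz) hε
  exact ⟨w, Submodule.orthogonalProjectionOnto_eq_zero_iff.1 hw, hwz⟩

/-- A dense subspace represents every orthogonal projection to a finite-dimensional subspace. -/
theorem exists_sub_mem_orthogonal {E' : Type*} [AddCommGroup E'] [Module ℝ E']
    [FiniteDimensional ℝ D] (ι : E' →ₗ[ℝ] E) (hι : DenseRange ι) (K : Submodule D E)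
    [Module.Finite D K] (z : E) : ∃ w, ι w - z ∈ orthogonal K := by
  have : FiniteDimensional ℝ (K.restrictScalars ℝ) := Module.Finite.trans (R := ℝ) D K
  obtain ⟨w, hw⟩ := ι.exists_map_eq_of_denseRange hι
    (K.restrictScalars ℝ).orthogonalProjectionOnto z
  exact ⟨w, Submodule.orthogonalProjectionOnto_eq_zero_iff.1 (by rw [map_sub, hw, sub_self])⟩

end IsStarInnerModule

/-- A vector orthogonal to a submodule is orthogonal to its limits. -/
theorem inner_eq_zero_of_approx {D E : Type*} [NormedDivisionRing D] [NormedAlgebra ℝ D]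
    [StarRing D] [NormedAddCommGroup E] [InnerProductSpace ℝ E] [Module D E] [IsScalarTower ℝ D E]
    [IsStarInnerModule D E] {K : Submodule D E} {m : E} (hm : m ∈ IsStarInnerModule.orthogonal K)
    {z : Completion E} (hz : ∀ ε > 0, ∃ x ∈ K, ‖(x : Completion E) - z‖ < ε) :
    inner ℝ (m : Completion E) z = 0 := by
  have hcl : IsClosed {x : Completion E | inner ℝ (m : Completion E) x = 0} :=
    isClosed_eq (continuous_const.inner continuous_id) continuous_const
  have hsub : ((↑) '' (K : Set E) : Set (Completion E)) ⊆
      {x : Completion E | inner ℝ (m : Completion E) x = 0} := by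
    rintro _ ⟨x, hx, rfl⟩
    change inner ℝ (m : Completion E) x = 0
    rw [Completion.inner_coe]
    exact IsStarInnerModule.mem_orthogonal.1 hm x hx
  refine hcl.closure_subset_iff.2 hsub (Metric.mem_closure_iff.2 fun ε hε => ?_)
  obtain ⟨x, hx, hxz⟩ := hz ε hε
  exact ⟨x, ⟨x, hx, rfl⟩, by rwa [dist_comm, dist_eq_norm]⟩

/-! ### The Amemiya–Araki theorem -/

section Completion

variable {D E : Type*} [NormedDivisionRing D] [NormedAlgebra ℝ D] [StarRing D]
  [NormedAddCommGroup E] [InnerProductSpace ℝ E] [Module D E] [IsScalarTower ℝ D E]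
  [IsStarInnerModule D E] [UniformContinuousConstSMul D E]

instance IsStarInnerModule.completion : IsStarInnerModule D (Completion E) where
  inner_smul_left a x y := by
    refine Completion.induction_on₂ x y (isClosed_eq ?_ ?_) fun u v => ?_
    · exact ((continuous_const_smul a).comp continuous_fst).inner continuous_snd
    · exact continuous_fst.inner ((continuous_const_smul (star a)).comp continuous_snd)
    · rw [← Completion.coe_smul, ← Completion.coe_smul, Completion.inner_coe, Completion.inner_coe,
        IsStarInnerModule.inner_smul_left]

variable (D E) in
/-- The `D`-linear embedding into the completion. -/
noncomputable def completionMap : E →ₗ[D] Completion E where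
  toFun := (↑)
  map_add' := Completion.coe_add
  map_smul' := Completion.coe_smul

open IsStarInnerModule

/-- Given orthogonal finite-dimensional `F`, `G` and orthogonal `z`, `y` in the completion with
`F ⟂ y` and `G ⟂ z`, the space `F` can be enlarged to approximate `z`. -/
theorem exists_orthogonal_extension [FiniteDimensional ℝ D] {z y : Completion E}
    (hzy : z ∈ orthogonal (Submodule.span D {y}))
    (F G : Submodule D E) [Module.Finite D F] [Module.Finite D G]
    (hFG : F ≤ orthogonal G) (hFy : F.map (completionMap D E) ≤ orthogonal (Submodule.span D {y}))
    (hGz : G.map (completionMap D E) ≤ orthogonal (Submodule.span D {z}))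
    {ε : ℝ} (hε : 0 < ε) :
    ∃ F' : Submodule D E, Module.Finite D F' ∧ F ≤ F' ∧ F' ≤ orthogonal G ∧
      F'.map (completionMap D E) ≤ orthogonal (Submodule.span D {y}) ∧
      ∃ x ∈ F', ‖(x : Completion E) - z‖ < ε := by
  -- Since `z` is orthogonal to this finite-dimensional space, its approximant `w` can be taken
  -- exactly orthogonal to `y` and to `G`.
  set K := Submodule.span D {y} ⊔ G.map (completionMap D E) with hK
  have hzK : z ∈ orthogonal K := by
    apply mem_orthogonal_comm (K := K) (L := Submodule.span D {z})
    · intro x hx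
      refine (sup_le ?_ hGz : K ≤ orthogonal (Submodule.span D {z})) hx
      apply mem_orthogonal_comm
      intro u hu
      exact (Submodule.span_singleton_le_iff_mem _ _).2 hzy hu
    · exact Submodule.mem_span_singleton_self z
  obtain ⟨w, hw, hwz⟩ := exists_mem_orthogonal_norm_sub_lt
    ((completionMap D E).restrictScalars ℝ) Completion.denseRange_coe K hzK hε
  refine ⟨F ⊔ Submodule.span D {w}, inferInstance, le_sup_left, sup_le hFG ?_, ?_, w,
    Submodule.mem_sup_right (Submodule.mem_span_singleton_self w), hwz⟩
  · rw [Submodule.span_singleton_le_iff_mem, mem_orthogonal]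
    intro u hu
    rw [← Completion.inner_coe]
    exact mem_orthogonal.1 hw _ (Submodule.mem_sup_right ⟨u, hu, rfl⟩)
  · rw [Submodule.map_sup]
    refine sup_le hFy ?_
    rw [Submodule.map_span, Set.image_singleton, Submodule.span_singleton_le_iff_mem]
    exact orthogonal_anti le_sup_left hw

/-- Orthogonal elements of the completion are limits of mutually orthogonal sequences. -/
theorem exists_orthogonal_approximation [FiniteDimensional ℝ D] {z y : Completion E}
    (hzy : z ∈ orthogonal (Submodule.span D {y})) :
    ∃ A B : Submodule D E, A ≤ orthogonal B ∧
      (∀ ε > 0, ∃ x ∈ A, ‖(x : Completion E) - z‖ < ε) ∧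
      ∀ ε > 0, ∃ x ∈ B, ‖(x : Completion E) - y‖ < ε := by
  have hyz : y ∈ orthogonal (Submodule.span D {z}) :=
    mem_orthogonal_comm ((Submodule.span_singleton_le_iff_mem _ _).2 hzy)
      y (Submodule.mem_span_singleton_self y)
  -- The states of an induction that enlarges the two spaces alternately; orthogonality to `y` and
  -- to `z` is the invariant that permits the next enlargement.
  let S : Type _ := {P : Submodule D E × Submodule D E // Module.Finite D P.1 ∧
    Module.Finite D P.2 ∧ P.1 ≤ orthogonal P.2 ∧
    P.1.map (completionMap D E) ≤ orthogonal (Submodule.span D {y}) ∧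
    P.2.map (completionMap D E) ≤ orthogonal (Submodule.span D {z})}
  have step : ∀ (n : ℕ) (P : S), ∃ Q : S, P.1.1 ≤ Q.1.1 ∧ P.1.2 ≤ Q.1.2 ∧
      (∃ x ∈ Q.1.1, ‖(x : Completion E) - z‖ < 1 / ((n : ℝ) + 1)) ∧
      ∃ x ∈ Q.1.2, ‖(x : Completion E) - y‖ < 1 / ((n : ℝ) + 1) := by
    rintro n ⟨⟨F, G⟩, hF, hG, hFG, hFy, hGz⟩
    dsimp only at hF hG hFG hFy hGz
    obtain ⟨F', hF', hFF', hF'G, hF'y, hx⟩ := exists_orthogonal_extension hzy F G hFG hFy hGz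
      (Nat.one_div_pos_of_nat (n := n) (α := ℝ))
    obtain ⟨G', hG', hGG', hG'F, hG'z, hx'⟩ := exists_orthogonal_extension hyz G F'
      (mem_orthogonal_comm hF'G) hGz hF'y (Nat.one_div_pos_of_nat (n := n) (α := ℝ))
    exact ⟨⟨⟨F', G'⟩, hF', hG', mem_orthogonal_comm hG'F, hF'y, hG'z⟩, hFF', hGG', hx, hx'⟩
  choose next hnext using step
  let P₀ : S := ⟨⟨⊥, ⊥⟩, inferInstance, inferInstance, bot_le, by simp, by simp⟩
  let P : ℕ → S := fun n => Nat.rec P₀ next n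
  have hP : ∀ n, P (n + 1) = next n (P n) := fun n => rfl
  have hmono1 : Monotone fun n => (P n).1.1 :=
    monotone_nat_of_le_succ fun n => by rw [hP]; exact (hnext n (P n)).1
  have hmono2 : Monotone fun n => (P n).1.2 :=
    monotone_nat_of_le_succ fun n => by rw [hP]; exact (hnext n (P n)).2.1
  refine ⟨⨆ n, (P n).1.1, ⨆ n, (P n).1.2, ?_, ?_, ?_⟩
  · refine iSup_le fun n x hx => mem_orthogonal.2 fun u hu => ?_
    obtain ⟨m, hm⟩ := (Submodule.mem_iSup_of_directed _ hmono2.directed_le).1 hu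
    have hx' := hmono1 (le_max_left n m) hx
    have hm' := hmono2 (le_max_right n m) hm
    exact mem_orthogonal.1 ((P (max n m)).2.2.2.1 hx') u hm'
  · intro ε hε
    obtain ⟨n, hn⟩ := exists_nat_one_div_lt hε
    obtain ⟨x, hx, hxz⟩ := (hnext n (P n)).2.2.1
    exact ⟨x, Submodule.mem_iSup_of_mem (n + 1) hx, hxz.trans hn⟩
  · intro ε hε
    obtain ⟨n, hn⟩ := exists_nat_one_div_lt hε
    obtain ⟨x, hx, hxz⟩ := (hnext n (P n)).2.2.2
    exact ⟨x, Submodule.mem_iSup_of_mem (n + 1) hx, hxz.trans hn⟩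

/-- The Amemiya–Araki theorem: an inner product space in which every biorthogonally closed
subspace splits is complete. -/
theorem completeSpace_of_orthogonal_split [FiniteDimensional ℝ D]
    (hsplit : ∀ K : Submodule D E, orthogonal (orthogonal K) = K →
      ∀ x, ∃ m ∈ K, x - m ∈ orthogonal K) : CompleteSpace E := by
  have hsurj : ∀ z : Completion E, ∃ x : E, (x : Completion E) = z := by
    intro z
    -- write `z + y = x` with `x` in the space and `y` orthogonal to `z`
    obtain ⟨x, hx⟩ : ∃ x : E, (x : Completion E) - z ∈ orthogonal (Submodule.span D {z}) := 
      exists_sub_mem_orthogonal ((completionMap D E).restrictScalars ℝ) Completion.denseRange_coe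
        (Submodule.span D {z}) z
    set y := (x : Completion E) - z
    have hzy : z ∈ orthogonal (Submodule.span D {y}) :=
      mem_orthogonal_comm ((Submodule.span_singleton_le_iff_mem _ _).2 hx)
        z (Submodule.mem_span_singleton_self z)
    have hyz : inner ℝ z y = 0 := mem_orthogonal.1 hzy y (Submodule.mem_span_singleton_self y)
    obtain ⟨A, B, hAB, hA, hB⟩ := exists_orthogonal_approximation hzy
    -- Here `m` is orthogonal to `B`, hence to its limit `y`; `x - m` lies in `Bᗮᗮ ≤ Aᗮ`, hence is
    -- orthogonal to `z`.
    obtain ⟨m, hm, hm'⟩ := hsplit (orthogonal B) (orthogonal_orthogonal_orthogonal B) x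
    have h1 := inner_eq_zero_of_approx hm hB
    have h2 := inner_eq_zero_of_approx (orthogonal_anti hAB hm') hA
    have h3 : inner ℝ (m : Completion E) ((x - m : E) : Completion E) = 0 := by
      rw [Completion.inner_coe, real_inner_comm]
      exact mem_orthogonal.1 hm' m hm
    have hxm : ((x - m : E) : Completion E) = z + y - m := by
      rw [Completion.coe_sub]; simp [y]
    refine ⟨m, ?_⟩
    rw [hxm] at h2 h3
    -- With `z ⟂ y`, these relations give `⟨z, z⟩ = ⟨z, m⟩ = ⟨m, m⟩`.
    have h4 : inner ℝ (z - (m : Completion E)) (z - (m : Completion E)) = 0 := by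
      simp only [inner_sub_left, inner_sub_right, inner_add_left, inner_add_right] at h2 h3 ⊢
      rw [real_inner_comm y z] at *
      rw [real_inner_comm (m : Completion E) z] at *
      linarith
    exact (sub_eq_zero.1 (inner_self_eq_zero.1 h4)).symm
  have hrange : IsComplete (Set.range ((↑) : E → Completion E)) := by
    rw [Set.range_eq_univ.2 hsurj]
    exact completeSpace_iff_isComplete_univ.1 inferInstance
  exact (Completion.coe_isometry.isUniformInducing).completeSpace hrange

end Completion

/-! ### Inner products over `D` as real inner products -/

theorem IsThetaProduct.zero_left {D V : Type*} [Ring D] [AddCommGroup V] [Module D V] {θ : D → D}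
    {f : V → V → D} (hf : IsThetaProduct θ f) (y : V) : f 0 y = 0 := by
  simpa using hf.smul_left 0 0 y

/-- The orthogonal complement of a set for a Hermitian form. -/
def IsThetaProduct.orthogonal {D V : Type*} [Ring D] [AddCommGroup V] [Module D V] {θ : D → D}
    {f : V → V → D} (hf : IsThetaProduct θ f) (S : Set V) : Submodule D V where
  carrier := {x | ∀ u ∈ S, f x u = 0}
  add_mem' {x y} hx hy u hu := by rw [hf.add_left, hx u hu, hy u hu, add_zero]
  zero_mem' u _ := hf.zero_left u
  smul_mem' a x hx u hu := by rw [hf.smul_left, hx u hu, mul_zero]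

theorem IsThetaProduct.mem_orthogonal {D V : Type*} [Ring D] [AddCommGroup V] [Module D V]
    {θ : D → D} {f : V → V → D} (hf : IsThetaProduct θ f) {S : Set V} {x : V} :
    x ∈ hf.orthogonal S ↔ ∀ u ∈ S, f x u = 0 := Iff.rfl

/-- The real part on `ℝ`, `ℂ` or `ℍ`. -/
theorem IsRealComplexOrQuaternion.exists_realPart {D : Type*} [NormedDivisionRing D]
    [NormedAlgebra ℝ D] [StarRing D] (hD : IsRealComplexOrQuaternion D) :
    ∃ t : D →ₗ[ℝ] ℝ, (∀ a, t (star a) = t a) ∧ ∀ r, t (algebraMap ℝ D r) = r := by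
  choose t ht using hD.exists_add_star
  have hinj := (algebraMap ℝ D).injective
  have hsmul : ∀ (r : ℝ) (a : D), star (r • a) = r • star a := fun r a => by
    rw [Algebra.smul_def, star_mul, hD.star_algebraMap, ← Algebra.commutes, Algebra.smul_def]
  refine ⟨{ toFun := fun a => t a / 2, map_add' := ?_, map_smul' := ?_ }, ?_, ?_⟩
  · intro a b
    have : t (a + b) = t a + t b := hinj (by
      rw [map_add, ← ht, ← ht, ← ht, star_add]; abel)
    rw [this, add_div]
  · intro r a
    have : t (r • a) = r * t a := hinj (by
      rw [map_mul, ← ht, ← ht, hsmul, ← smul_add, Algebra.smul_def])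
    rw [this, mul_div_assoc]
    rfl
  · intro a
    have : t (star a) = t a := hinj (by rw [← ht, ← ht, star_star, add_comm])
    change t (star a) / 2 = t a / 2
    rw [this]
  · intro r
    have : t (algebraMap ℝ D r) = r + r := hinj (by rw [← ht, hD.star_algebraMap, map_add])
    change t (algebraMap ℝ D r) / 2 = r
    rw [this]
    ring

theorem IsRealComplexOrQuaternion.norm_star {D : Type*} [NormedDivisionRing D]
    [NormedAlgebra ℝ D] [StarRing D] (hD : IsRealComplexOrQuaternion D) (a : D) :
    ‖star a‖ = ‖a‖ := by
  by_cases ha : a = 0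
  · simp [ha]
  · have h := congrArg norm (hD.mul_star_self a)
    rw [norm_mul, norm_algebraMap', Real.norm_of_nonneg (by positivity), sq] at h
    exact mul_left_cancel₀ (norm_ne_zero_iff.2 ha) h

/-- This makes `star a` adjoint to `a` for the real inner product `Re f`, even over ℍ. -/
theorem IsRealComplexOrQuaternion.realPart_mul_comm {D : Type*} [NormedDivisionRing D]
    [NormedAlgebra ℝ D] [StarRing D] (hD : IsRealComplexOrQuaternion D) {t : D →ₗ[ℝ] ℝ}
    (ht : ∀ a, t (star a) = t a) (a b : D) :
    t (a * b) = t (b * a) := by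
  -- polarise `c * star c = star c * c`
  have hself : ∀ c, t (c * star c) = t (star c * c) := fun c => by
    have := hD.mul_star_self (star c)
    rw [star_star] at this
    rw [hD.mul_star_self, this, hD.norm_star]
  have h := hself (a + star b)
  simp only [star_add, star_star, mul_add, add_mul, map_add] at h
  have h1 := hself a
  have h2 := hself b
  have h3 : t (star b * star a) = t (a * b) := by rw [← star_mul, ht]
  have h4 : t (star a * star b) = t (b * a) := by rw [← star_mul, ht]
  linarith

namespace IsInnerProduct

section

variable {D V : Type*} [NormedDivisionRing D] [NormedAlgebra ℝ D] [StarRing D]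
  [AddCommGroup V] [Module D V] {f : V → V → D}

theorem self_eq (hf : IsInnerProduct f) (x : V) : f x x = algebraMap ℝ D ‖f x x‖ := by
  by_cases hx : x = 0
  · rw [hx, hf.zero_left, norm_zero, map_zero]
  · obtain ⟨r, hr, h⟩ := hf.pos x hx
    rw [h, norm_algebraMap', Real.norm_of_nonneg hr.le]

/-- The real inner product `Re f`. -/
@[reducible] noncomputable def realCore [Module ℝ V] [IsScalarTower ℝ D V] (hf : IsInnerProduct f)
    {t : D →ₗ[ℝ] ℝ} (ht : ∀ a, t (star a) = t a) (htr : ∀ r, t (algebraMap ℝ D r) = r) :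
    InnerProductSpace.Core ℝ V where
  inner x y := t (f x y)
  conj_inner_symm x y := by
    rw [← hf.hermitian, ht]; rfl
  re_inner_nonneg x := by
    change 0 ≤ t (f x x)
    rw [hf.self_eq, htr]
    positivity
  add_left x y z := by rw [hf.add_left, map_add]
  smul_left x y r := by
    change t (f (r • x) y) = r * t (f x y)
    rw [← algebraMap_smul D r x, hf.smul_left, ← Algebra.smul_def, map_smul, smul_eq_mul]
  definite x h := by
    rw [hf.self_eq, htr] at h
    exact hf.definite x (norm_eq_zero.1 h)

end

section

variable {D V : Type*} [NormedDivisionRing D] [NormedAlgebra ℝ D] [StarRing D]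
  [NormedAddCommGroup V] [InnerProductSpace ℝ V] [Module D V] {f : V → V → D}
  {t : D →ₗ[ℝ] ℝ}

theorem formNorm_eq (hf : IsInnerProduct f) (htr : ∀ r, t (algebraMap ℝ D r) = r)
    (hinner : ∀ x y : V, inner ℝ x y = t (f x y)) (x : V) : formNorm f x = ‖x‖ := by
  rw [norm_eq_sqrt_real_inner, hinner, hf.self_eq, htr]
  rfl

theorem norm_smul_eq (hD : IsRealComplexOrQuaternion D) (hf : IsInnerProduct f)
    (htr : ∀ r, t (algebraMap ℝ D r) = r)
    (hinner : ∀ x y : V, inner ℝ x y = t (f x y)) (a : D) (x : V) : ‖a • x‖ = ‖a‖ * ‖x‖ := by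
  rw [← hf.formNorm_eq htr hinner, ← hf.formNorm_eq htr hinner, formNorm, formNorm,
    hf.smul_left, hf.smul_right, norm_mul, norm_mul, hD.norm_star,
    show ‖a‖ * (‖f x x‖ * ‖a‖) = ‖a‖ ^ 2 * ‖f x x‖ by ring,
    Real.sqrt_mul (by positivity), Real.sqrt_sq (norm_nonneg a)]

theorem uniformContinuousConstSMul (hD : IsRealComplexOrQuaternion D) (hf : IsInnerProduct f)
    (htr : ∀ r, t (algebraMap ℝ D r) = r)
    (hinner : ∀ x y : V, inner ℝ x y = t (f x y)) : UniformContinuousConstSMul D V :=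
  ⟨fun a => (LipschitzWith.of_dist_le_mul (K := ‖a‖₊) fun x y => by
    rw [dist_eq_norm, dist_eq_norm, ← smul_sub, hf.norm_smul_eq hD htr hinner]
    rfl).uniformContinuous⟩

theorem isStarInnerModule (hf : IsInnerProduct f) (ht : ∀ a, t (star a) = t a)
    (hD : IsRealComplexOrQuaternion D)
    (hinner : ∀ x y : V, inner ℝ x y = t (f x y)) : IsStarInnerModule D V where
  inner_smul_left a x y := by
    rw [hinner, hinner, hf.smul_left, hf.smul_right, star_star, hD.realPart_mul_comm ht]

theorem isHilbertSpace_of_completeSpace [CompleteSpace V] (hf : IsInnerProduct f)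
    (htr : ∀ r, t (algebraMap ℝ D r) = r)
    (hinner : ∀ x y : V, inner ℝ x y = t (f x y)) : IsHilbertSpace f where
  toIsInnerProduct := hf
  complete s hs := by
    simp only [hf.formNorm_eq htr hinner, ← dist_eq_norm] at hs ⊢
    obtain ⟨x, hx⟩ := cauchySeq_tendsto_of_complete (Metric.cauchySeq_iff.2 hs)
    exact ⟨x, Metric.tendsto_atTop.1 hx⟩

theorem isClosedForForm_iff_isClosed (hf : IsInnerProduct f)
    (htr : ∀ r, t (algebraMap ℝ D r) = r)
    (hinner : ∀ x y : V, inner ℝ x y = t (f x y)) (S : Set V) :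
    IsClosedForForm f S ↔ IsClosed S := by
  simp only [IsClosedForForm, hf.formNorm_eq htr hinner, ← dist_eq_norm]
  rw [← closure_subset_iff_isClosed]
  simp only [Set.subset_def, Metric.mem_closure_iff]

/-- Testing against `f x u • u` turns the real part into `‖f x u‖ ^ 2`. -/
theorem orthogonal_eq [IsScalarTower ℝ D V] [IsStarInnerModule D V]
    (hD : IsRealComplexOrQuaternion D) (hf : IsInnerProduct f)
    (htr : ∀ r, t (algebraMap ℝ D r) = r)
    (hinner : ∀ x y : V, inner ℝ x y = t (f x y)) (K : Submodule D V) :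
    hf.orthogonal (K : Set V) = IsStarInnerModule.orthogonal K := by
  ext x
  rw [hf.mem_orthogonal, IsStarInnerModule.mem_orthogonal]
  refine ⟨fun h u hu => by rw [hinner, h u hu, map_zero], fun h u hu => ?_⟩
  have h1 := h (f x u • u) (K.smul_mem _ hu)
  rw [hinner, hf.smul_right, hD.mul_star_self, htr] at h1
  exact norm_eq_zero.1 (pow_eq_zero_iff two_ne_zero |>.1 h1)

end

section

variable {D V : Type*} [NormedDivisionRing D] [NormedAlgebra ℝ D] [StarRing D]
  [AddCommGroup V] [Module D V] {f : V → V → D}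

/-- The Amemiya–Araki theorem for an inner product over `ℝ`, `ℂ` or `ℍ`. -/
theorem isHilbertSpace_of_split (hD : IsRealComplexOrQuaternion D) (hf : IsInnerProduct f)
    (hsplit : ∀ K : Submodule D V, hf.orthogonal (hf.orthogonal (K : Set V) : Set V) = K →
      ∀ x, ∃ m ∈ K, x - m ∈ hf.orthogonal (K : Set V)) :
    IsHilbertSpace f ∧ ∀ K : Submodule D V,
      hf.orthogonal (hf.orthogonal (K : Set V) : Set V) = K ↔ IsClosedForForm f (K : Set V) := by
  obtain ⟨t, ht, htr⟩ := hD.exists_realPart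
  have := hD.finiteDimensional
  let : Module ℝ V := Module.compHom V (algebraMap ℝ D)
  have : IsScalarTower ℝ D V := ⟨fun r a x => by
    rw [Algebra.smul_def, mul_smul]; rfl⟩
  let : NormedAddCommGroup V := (hf.realCore ht htr).toNormedAddCommGroup
  let : InnerProductSpace ℝ V := .ofCore (hf.realCore ht htr).toCore
  have hinner : ∀ x y : V, inner ℝ x y = t (f x y) := fun _ _ => rfl
  have := hf.isStarInnerModule ht hD hinner
  have := hf.uniformContinuousConstSMul hD htr hinner
  have horth := hf.orthogonal_eq hD htr hinner
  simp only [horth] at hsplit ⊢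
  have := completeSpace_of_orthogonal_split hsplit
  refine ⟨hf.isHilbertSpace_of_completeSpace htr hinner, fun K => ?_⟩
  rw [hf.isClosedForForm_iff_isClosed htr hinner]
  have hK : IsStarInnerModule.orthogonal (IsStarInnerModule.orthogonal K) = K ↔
      (K.restrictScalars ℝ)ᗮᗮ = K.restrictScalars ℝ := by
    rw [SetLike.ext_iff, SetLike.ext_iff]
    rfl
  rw [hK, Submodule.orthogonal_orthogonal_eq_closure]
  constructor
  · intro h
    have := (K.restrictScalars ℝ).isClosed_topologicalClosure
    rwa [h] at this
  · exact fun h => IsClosed.submodule_topologicalClosure_eq h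

theorem isHilbertSpace_of_finite [Module.Finite D V] (hD : IsRealComplexOrQuaternion D)
    (hf : IsInnerProduct f) :
    IsHilbertSpace f ∧ ∀ K : Submodule D V, IsClosedForForm f (K : Set V) := by
  obtain ⟨t, ht, htr⟩ := hD.exists_realPart
  have := hD.finiteDimensional
  let : Module ℝ V := Module.compHom V (algebraMap ℝ D)
  have : IsScalarTower ℝ D V := ⟨fun r a x => by
    rw [Algebra.smul_def, mul_smul]; rfl⟩
  have : FiniteDimensional ℝ V := Module.Finite.trans (R := ℝ) D V
  let : NormedAddCommGroup V := (hf.realCore ht htr).toNormedAddCommGroup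
  let : InnerProductSpace ℝ V := .ofCore (hf.realCore ht htr).toCore
  have hinner : ∀ x y : V, inner ℝ x y = t (f x y) := fun _ _ => rfl
  have : CompleteSpace V := FiniteDimensional.complete ℝ V
  refine ⟨hf.isHilbertSpace_of_completeSpace htr hinner, fun K => ?_⟩
  rw [hf.isClosedForForm_iff_isClosed htr hinner]
  exact Submodule.closed_of_finiteDimensional (K.restrictScalars ℝ)

/-- A finite-dimensional space carries an inner product. -/
theorem exists_of_finite (D V : Type*) [NormedDivisionRing D] [NormedAlgebra ℝ D] [StarRing D]
    [AddCommGroup V] [Module D V] [Module.Finite D V] (hD : IsRealComplexOrQuaternion D) :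
    ∃ f : V → V → D, IsInnerProduct f := by
  set b := Module.finBasis D V
  have hself : ∀ x : V, ∑ i, b.repr x i * star (b.repr x i) =
      algebraMap ℝ D (∑ i, ‖b.repr x i‖ ^ 2) := fun x => by
    rw [map_sum]
    exact Finset.sum_congr rfl fun i _ => hD.mul_star_self _
  have hpos : ∀ x : V, x ≠ 0 → 0 < ∑ i, ‖b.repr x i‖ ^ 2 := by
    intro x hx
    refine lt_of_le_of_ne (by positivity) fun h => hx ?_
    rw [eq_comm, Finset.sum_eq_zero_iff_of_nonneg fun i _ => by positivity] at h
    apply b.ext_elem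
    intro i
    simpa using h i (Finset.mem_univ i)
  refine ⟨fun x y => ∑ i, b.repr x i * star (b.repr y i), ⟨?_, ?_, ?_, ?_, ?_, ?_⟩, ?_⟩
  · intro x₁ x₂ y
    simp [add_mul, Finset.sum_add_distrib]
  · intro a x y
    simp [Finset.mul_sum, mul_assoc]
  · intro x y₁ y₂
    simp [mul_add, Finset.sum_add_distrib]
  · intro a x y
    simp [Finset.sum_mul, mul_assoc]
  · intro x y
    simp [star_sum]
  · intro x hx
    by_contra h0
    rw [hself, map_eq_zero] at hx
    exact (hpos x h0).ne' hx
  · exact fun x hx => ⟨_, hpos x hx, hself x⟩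

end

end IsInnerProduct

/-! ### Closed subspaces and the orthomodular law -/

section

variable {D V : Type*} [NormedDivisionRing D] [NormedAlgebra ℝ D] [AddCommGroup V] [Module D V]
  [TopologicalSpace V] [IsTopologicalAddGroup V] [ContinuousSMul D V]

/-- `K` stays finite-dimensional over ℝ, where the result is known. It puts `M + Dx` into the
lattice. -/
theorem ClosedSubmodule.isClosed_sup_of_finite [FiniteDimensional ℝ D] (M : ClosedSubmodule D V)
    (K : Submodule D V) [Module.Finite D K] :
    IsClosed ((M.toSubmodule ⊔ K : Submodule D V) : Set V) := by
  let : Module ℝ V := Module.compHom V (algebraMap ℝ D)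
  have : IsScalarTower ℝ D V := ⟨fun r a x => by rw [Algebra.smul_def, mul_smul]; rfl⟩
  have : ContinuousSMul ℝ V :=
    ⟨((continuous_algebraMap ℝ D).comp continuous_fst).smul continuous_snd⟩
  have : FiniteDimensional ℝ (K.restrictScalars ℝ) := Module.Finite.trans (R := ℝ) D K
  have h := Submodule.isClosed_sup_finiteDimensional (M.toSubmodule.restrictScalars ℝ)
    (K.restrictScalars ℝ) M.isClosed
  rwa [← Submodule.restrictScalars_sup] at h

theorem Submodule.isClosed_of_finite [T2Space V] [FiniteDimensional ℝ D] (K : Submodule D V)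
    [Module.Finite D K] : IsClosed (K : Set V) := by
  simpa using ClosedSubmodule.isClosed_sup_of_finite (⊥ : ClosedSubmodule D V) K

end

section

variable {D V : Type*} [NormedDivisionRing D] [AddCommGroup V] [Module D V]
  [TopologicalSpace V] [IsTopologicalAddGroup V] [ContinuousSMul D V]

theorem ClosedSubmodule.closure_span_singleton_le {u : V} {U : ClosedSubmodule D V} :
    (Submodule.span D {u}).closure ≤ U ↔ u ∈ U := by
  rw [Submodule.closure_le, Submodule.span_singleton_le_iff_mem]
  rfl

end

theorem IsOrthomodular.conj {W L : Type*} [Lattice W] [BoundedOrder W] [Lattice L]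
    [BoundedOrder L] {perp : W → W} (h : IsOrthomodular perp) (e : W ≃o L) :
    IsOrthomodular fun U => e (perp (e.symm U)) where
  perp_perp x := by simp [h.perp_perp]
  le_iff x y := by rw [e.le_iff_le, ← h.le_iff, e.symm.le_iff_le]
  inf_perp x := by
    have := congrArg e (h.inf_perp (e.symm x))
    simpa using this
  sup_perp x := by
    have := congrArg e (h.sup_perp (e.symm x))
    simpa using this
  orthomodular x z hxz := by
    have := congrArg e (h.orthomodular _ _ (e.symm.monotone hxz))
    simpa using this

namespace IsOrthomodular

variable {D V : Type*} [NormedDivisionRing D] [NormedAlgebra ℝ D] [AddCommGroup V] [Module D V]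
  [TopologicalSpace V] [T2Space V] [IsTopologicalAddGroup V] [ContinuousSMul D V]
  {P : ClosedSubmodule D V → ClosedSubmodule D V}

/-- In an orthomodular lattice of closed subspaces, every member splits the space. -/
theorem exists_mem_sub_mem [FiniteDimensional ℝ D] (hP : IsOrthomodular P)
    (M : ClosedSubmodule D V) (x : V) : ∃ m ∈ M, x - m ∈ P M := by
  by_cases hx : x ∈ M
  · exact ⟨x, hx, by rw [sub_self]; exact (P M).zero_mem⟩
  -- As `N` is strictly larger than `M`, orthomodularity yields a nonzero `m + a • x` in `P M`. Here
  -- `a ≠ 0` because `M ⊓ P M = ⊥`, and division by `a` splits `x`.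
  let N : ClosedSubmodule D V := ⟨M.toSubmodule ⊔ Submodule.span D {x},
    M.isClosed_sup_of_finite _⟩
  have hMN : M ≤ N := fun m hm => Submodule.mem_sup_left hm
  have hxN : x ∈ N := Submodule.mem_sup_right (Submodule.mem_span_singleton_self x)
  have hne : P M ⊓ N ≠ ⊥ := by
    intro h
    have := hP.orthomodular M N hMN
    rw [h, sup_bot_eq] at this
    exact hx (this ▸ hxN)
  obtain ⟨y, ⟨hy, hyN⟩, hy0⟩ : ∃ y ∈ P M ⊓ N, y ≠ 0 := by
    by_contra! hcon
    exact hne (le_bot_iff.1 fun y hy => hcon y hy)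
  obtain ⟨m, hm, z, hz, rfl⟩ := Submodule.mem_sup.1 hyN
  obtain ⟨a, rfl⟩ := Submodule.mem_span_singleton.1 hz
  have ha : a ≠ 0 := by
    rintro rfl
    rw [zero_smul, add_zero] at hy hy0
    have : m ∈ M ⊓ P M := ⟨hm, hy⟩
    rw [hP.inf_perp] at this
    exact hy0 this
  refine ⟨-(a⁻¹ • m), M.toSubmodule.neg_mem (M.toSubmodule.smul_mem _ hm), ?_⟩
  have := (P M).toSubmodule.smul_mem a⁻¹ hy
  rw [smul_add, smul_smul, inv_mul_cancel₀ ha, one_smul] at this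
  rw [sub_neg_eq_add, add_comm]
  exact this

theorem mem_perp_comm (hP : IsOrthomodular P) {v : V} {U : ClosedSubmodule D V} :
    v ∈ P U ↔ U ≤ P (Submodule.span D {v}).closure := by
  rw [← ClosedSubmodule.closure_span_singleton_le, hP.le_iff, hP.perp_perp]

theorem isAnisotropicPolarity [FiniteDimensional ℝ D] (hP : IsOrthomodular P) :
    IsAnisotropicPolarity fun u : V => (P (Submodule.span D {u}).closure).toSubmodule where
  symm u v h := by
    exact ClosedSubmodule.closure_span_singleton_le.1 (hP.mem_perp_comm.1 h)
  eq_zero u h := by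
    have : u ∈ (Submodule.span D {u}).closure ⊓ P (Submodule.span D {u}).closure :=
      ⟨ClosedSubmodule.closure_span_singleton_le.1 le_rfl, h⟩
    rw [hP.inf_perp] at this
    exact this
  split u v := by
    obtain ⟨m, hm, hvm⟩ := hP.exists_mem_sub_mem (Submodule.span D {u}).closure v
    rw [Submodule.closure_eq' (Submodule.isClosed_of_finite (Submodule.span D {u}))] at hm
    obtain ⟨a, rfl⟩ := Submodule.mem_span_singleton.1 hm
    exact ⟨a, hvm⟩

theorem perp_eq_orthogonal {θ : D → D} {f : V → V → D} (hP : IsOrthomodular P)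
    (hf : IsThetaProduct θ f)
    (hker : ∀ v u : V, f v u = 0 ↔ v ∈ P (Submodule.span D {u}).closure)
    (U : ClosedSubmodule D V) : (P U).toSubmodule = hf.orthogonal (U : Set V) := by
  ext v
  rw [hf.mem_orthogonal, ClosedSubmodule.mem_toSubmodule_iff, hP.mem_perp_comm]
  have : ∀ u, f v u = 0 ↔ u ∈ P (Submodule.span D {v}).closure := fun u => by
    rw [hker, hP.mem_perp_comm, ClosedSubmodule.closure_span_singleton_le]
  simp only [this]
  rfl

theorem isClosed_orthogonal {θ : D → D} {f : V → V → D} (hf : IsThetaProduct θ f)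
    (hker : ∀ v u : V, f v u = 0 ↔ v ∈ P (Submodule.span D {u}).closure) (S : Set V) :
    IsClosed (hf.orthogonal S : Set V) := by
  have : (hf.orthogonal S : Set V) = ⋂ u ∈ S, (P (Submodule.span D {u}).closure : Set V) := by
    ext v
    simp only [Set.mem_iInter]
    exact forall₂_congr fun u _ => hker v u
  rw [this]
  exact isClosed_biInter fun u _ => (P _).isClosed

/-- On the lattice, `P` is the orthogonal of `f` and is involutive; conversely an orthogonal is an
intersection of closed polars. -/
theorem isClosed_iff_orthogonal_orthogonal {θ : D → D} {f : V → V → D} (hP : IsOrthomodular P)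
    (hf : IsThetaProduct θ f)
    (hker : ∀ v u : V, f v u = 0 ↔ v ∈ P (Submodule.span D {u}).closure) (K : Submodule D V) :
    IsClosed (K : Set V) ↔ hf.orthogonal (hf.orthogonal (K : Set V) : Set V) = K := by
  constructor
  · intro hK
    have h1 := hP.perp_eq_orthogonal hf hker ⟨K, hK⟩
    have h2 := hP.perp_eq_orthogonal hf hker (P ⟨K, hK⟩)
    rw [hP.perp_perp, ← ClosedSubmodule.coe_toSubmodule, h1] at h2
    exact h2.symm
  · intro h
    rw [← h]
    exact isClosed_orthogonal hf hker _

end IsOrthomodular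

/-! ### The theorem -/

theorem exists_notMem_span_pair {D V : Type*} [DivisionRing D] [AddCommGroup V] [Module D V]
    (h : 4 ≤ Module.rank D V) (a b : V) : ∃ w, w ∉ Submodule.span D {a, b} := by
  by_contra! hcon
  have htop : Submodule.span D {a, b} = ⊤ := Submodule.eq_top_iff'.2 hcon
  have h1 := rank_span_le (R := D) ({a, b} : Set V)
  rw [htop, rank_top] at h1
  have h2 : Cardinal.mk ({a, b} : Set V) ≤ 2 := by
    refine (Cardinal.mk_insert_le).trans ?_
    rw [Cardinal.mk_singleton, one_add_one_eq_two]
  have h3 := h.trans (h1.trans h2)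
  norm_num at h3

theorem theorem4p1
    {D : Type*} [NormedDivisionRing D] [NormedAlgebra ℝ D] [StarRing D]
    (hD : IsRealComplexOrQuaternion D)
    {W : Type*} [CompleteLattice W] [IsAtomic W]
    (perp : W → W) (hW : IsOrthomodular perp)
    {V : Type*} [AddCommGroup V] [Module D V] [TopologicalSpace V] [T2Space V]
    [IsTopologicalAddGroup V] [ContinuousSMul D V]
    (e : W ≃o ClosedSubmodule D V)
    (hθ : 4 ≤ Module.rank D V → ∀ θ : D → D,
      IsAssociatedAntiAut (fun U : ClosedSubmodule D V => e (perp (e.symm U))) θ →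
        Continuous θ) :
    ∃ f : V → V → D, IsHilbertSpace f ∧
      (∀ U : Submodule D V, IsClosed (U : Set V) ↔ IsClosedForForm f (U : Set V)) ∧
      (4 ≤ Module.rank D V → ∀ (q : W) (v : V),
        v ∈ e (perp q) ↔ ∀ u ∈ e q, f v u = 0) := by
  have := hD.finiteDimensional
  by_cases hrank : 4 ≤ Module.rank D V
  · have hP := hW.conj e
    set P := fun U : ClosedSubmodule D V => e (perp (e.symm U)) with hPdef
    have hdim := exists_notMem_span_pair hrank
    obtain ⟨θ, v₁, f, hθ', hv₁, hf, hf1, hker⟩ := hP.isAnisotropicPolarity.exists_form hdim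
    have hc : Continuous θ := hθ hrank θ ⟨hθ', v₁, f, hv₁, hf, hf1, hker⟩
    -- The component of `w` orthogonal to `v₁` is the second vector required for positivity.
    obtain ⟨w, hw⟩ := hdim v₁ v₁
    have hinner : IsInnerProduct f := by
      refine hf.isInnerProduct hD hθ' hc hf1 (x₀ := w - f w v₁ • v₁) ?_ ?_
      · have h1 := hf.add_left (w - f w v₁ • v₁) (f w v₁ • v₁) v₁
        rw [sub_add_cancel, hf.smul_left, hf1, mul_one] at h1
        simpa using h1
      · intro h
        apply hw
        rw [sub_eq_zero.1 h]
        exact Submodule.smul_mem _ _ (Submodule.subset_span (by simp))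
    have hf := hinner.toIsThetaProduct
    have hclosed := hP.isClosed_iff_orthogonal_orthogonal hf hker
    obtain ⟨hH, hHc⟩ := hinner.isHilbertSpace_of_split hD fun K hK x => by
      have hKc := (hclosed K).2 hK
      obtain ⟨m, hm, hxm⟩ := hP.exists_mem_sub_mem ⟨K, hKc⟩ x
      rw [← ClosedSubmodule.mem_toSubmodule_iff, hP.perp_eq_orthogonal hf hker] at hxm
      exact ⟨m, hm, hxm⟩
    refine ⟨f, hH, fun U => (hclosed U).trans (hHc U), fun _ q v => ?_⟩
    have h1 := hP.perp_eq_orthogonal hf hker (e q)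
    have h2 : P (e q) = e (perp q) := by simp [hPdef]
    rw [h2] at h1
    rw [← ClosedSubmodule.mem_toSubmodule_iff, h1]
    rfl
  · have : Module.Finite D V := by
      rw [← Module.rank_lt_aleph0_iff]
      exact (not_le.1 hrank).trans (Cardinal.natCast_lt_aleph0 (n := 4))
    obtain ⟨f, hf⟩ := IsInnerProduct.exists_of_finite D V hD
    obtain ⟨hH, hHc⟩ := hf.isHilbertSpace_of_finite hD
    exact ⟨f, hH, fun U => ⟨fun _ => hHc U, fun _ => U.isClosed_of_finite⟩,
      fun h => absurd h hrank⟩
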